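/- Let $q$ be an indeterminate. For integers $n, m$ let $$\begin{bmatrix} n \\ m \end{bmatrix} = \frac{\prod_{k=1}^{n}(1-q^k)}{\prod_{k=1}^{m}(1-q^k)\,\prod_{k=1}^{n-m}(1-q^k)} \ \text{ if } 0 \le m \le n, \qquad \begin{bmatrix} n \\ m \end{bmatrix} = 0 \ \text{ otherwise},$$ an element of $\mathbb{Q}(q)$. For a partition $\lambda$ let $m_i(\lambda)$ be the number of parts of $\lambda$ equal to $i$, and for an integer $L \ge 0$ put $$p_i(\lambda) = L - 2\sum_{j \ge 1} \min(i,j)\, m_j(\lambda), \qquad \phi(\lambda) = \sum_{i,j \ge 1} \min(i,j)\, m_i(\lambda)\, m_j(\lambda).$$ Let $L$ and $s$ be integers, and let $\lambda \vdash s$ mean that $\lambda$ runs over all partitions of $s$. If $0 \le s \le L$, then $$\begin{bmatrix} L \\ s \end{bmatrix} = q^{-s} \sum_{\lambda \vdash s} q^{\phi(\lambda)} \prod_{i \ge 1} \begin{bmatrix} p_i(\lambda) + m_i(\lambda) + i \\ m_i(\lambda) \end{bmatrix},$$ and if $0 \le s \le L/2$, then $$\begin{bmatrix} L \\ s \end{bmatrix}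 - \begin{bmatrix} L \\ s-1 \end{bmatrix} = \sum_{\lambda \vdash s} q^{\phi(\lambda)} \prod_{i \ge 1} \begin{bmatrix} p_i(\lambda) + m_i(\lambda) \\ m_i(\lambda) \end{bmatrix}.$$ -/

import Mathlib

noncomputable section

/-- The `q`-binomial coefficient `[n, m]` for integers `n`, `m`, as a rational function of the
indeterminate `q = RatFunc.X` over `ℚ`:
`∏_{k=1}^n (1 - q^k) / (∏_{k=1}^m (1 - q^k) * ∏_{k=1}^{n-m} (1 - q^k))` if `0 ≤ m ≤ n`,
and `0` otherwise (in particular `[n, 0] = 0` for `n < 0`). -/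
def qBinom (n m : ℤ) : RatFunc ℚ :=
  if 0 ≤ m ∧ m ≤ n then
    (∏ k ∈ Finset.Icc 1 n.toNat, (1 - (RatFunc.X : RatFunc ℚ) ^ k)) /
      ((∏ k ∈ Finset.Icc 1 m.toNat, (1 - (RatFunc.X : RatFunc ℚ) ^ k)) *
        ∏ k ∈ Finset.Icc 1 (n - m).toNat, (1 - (RatFunc.X : RatFunc ℚ) ^ k))
  else 0

/-- `m_i(λ)`: the number of parts of `λ` equal to `i`. -/
def partMult {s : ℕ} (lam : s.Partition) (i : ℕ) : ℕ :=
  lam.parts.count i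

/-- `p_i(λ) = L - 2 ∑_{j ≥ 1} min(i, j) m_j(λ)`, an integer that may be negative.
The parts of a partition of `s` are at most `s`, so `j` runs over `1, …, s`. -/
def vacancy (L : ℕ) {s : ℕ} (lam : s.Partition) (i : ℕ) : ℤ :=
  (L : ℤ) - 2 * ∑ j ∈ Finset.Icc 1 s, ((min i j * partMult lam j : ℕ) : ℤ)

/-- `φ(λ) = ∑_{i, j ≥ 1} min(i, j) m_i(λ) m_j(λ)`. -/
def phiEnergy {s : ℕ} (lam : s.Partition) : ℕ :=
  ∑ i ∈ Finset.Icc 1 s, ∑ j ∈ Finset.Icc 1 s, min i j * partMult lam i * partMult lam j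

end

/-! ### Gaussian binomials from the Pascal recursion. -/

section GaussBinom

/-! Both identities are refined by the number `n` of parts of `λ`, that is, by the length of the
first column of its diagram. Deleting that column turns a partition of `s + n` with `n` parts into a
partition of `s` with `k ≤ n` parts. The energy drops by `n ^ 2`, the factor `i = 1` splits off with
`m_1 = n - k`, and the other factors keep their shape with `L` replaced by `L - 2n + c`; here `c =
1` for the first identity and `c = 0` for the second. This is the recursion `configSum_succ`.

The recursion has product solutions. For `c = 1` and `s = b + 1` the sum over partitions with `n`
parts is `q^(s + n(n-1)) [L-b, n] [b, n-1]`; for `c = 0` and `L = 2s + d` it is `q^(s + n(n-1)) (1 -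
q^(d+1)) / (1 - q^(s+d+1)) [s+d+1, n] [b, n-1]`. The induction step in `configSum_one_eq` and
`configSum_zero_mul_eq` is the `q`-Pfaff–Saalschütz sum. Summing over `n` by `q`-Vandermonde gives
`q^s [L, s]` and `[L, s] - [L, s-1]` respectively. -/

/-- The Gaussian binomial coefficient, defined by the `q`-Pascal recursion. -/
def gaussBinom {R : Type*} [CommSemiring R] (q : R) : ℕ → ℕ → R
  | _, 0 => 1
  | 0, _ + 1 => 0
  | n + 1, k + 1 => gaussBinom q n k + q ^ (k + 1) * gaussBinom q n (k + 1)

/-- The `q`-Pochhammer product `∏_{k=1}^n (1 - q^k)`. -/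
def qPoch {R : Type*} [CommRing R] (q : R) (n : ℕ) : R :=
  ∏ k ∈ Finset.Icc 1 n, (1 - q ^ k)

@[simp] lemma gaussBinom_zero_right {R : Type*} [CommSemiring R] (q : R) (n : ℕ) :
    gaussBinom q n 0 = 1 := by
  cases n <;> rfl

lemma gaussBinom_succ_succ {R : Type*} [CommSemiring R] (q : R) (n k : ℕ) :
    gaussBinom q (n + 1) (k + 1) =
      gaussBinom q n k + q ^ (k + 1) * gaussBinom q n (k + 1) := rfl

lemma gaussBinom_eq_zero_of_lt {R : Type*} [CommSemiring R] (q : R) {n k : ℕ} (h : n < k) :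
    gaussBinom q n k = 0 := by
  induction n generalizing k with
  | zero =>
    obtain ⟨k, rfl⟩ := Nat.exists_eq_add_of_lt h
    rfl
  | succ n ih =>
    obtain ⟨k, rfl⟩ : ∃ j, k = j + 1 := ⟨k - 1, by omega⟩
    rw [gaussBinom_succ_succ, ih (by omega), ih (by omega)]
    simp

@[simp] lemma gaussBinom_self {R : Type*} [CommSemiring R] (q : R) (n : ℕ) :
    gaussBinom q n n = 1 := by
  induction n with
  | zero => rfl
  | succ n ih => rw [gaussBinom_succ_succ, ih, gaussBinom_eq_zero_of_lt q (by omega)]; simp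

/-- The `q`-Vandermonde convolution. -/
theorem gaussBinom_add_left {R : Type*} [CommSemiring R] (q : R) (m n K : ℕ) :
    gaussBinom q (m + n) K =
      ∑ p ∈ Finset.HasAntidiagonal.antidiagonal K,
        q ^ ((m - p.1) * p.2) * gaussBinom q m p.1 * gaussBinom q n p.2 := by
  induction m generalizing K with
  | zero =>
    cases K with
    | zero => simp
    | succ K =>
      rw [Finset.Nat.sum_antidiagonal_succ, Finset.sum_eq_zero]
      · simp
      · intro p _
        rw [gaussBinom_eq_zero_of_lt q (Nat.succ_pos p.1)]
        simp
  | succ m ih =>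
    cases K with
    | zero => simp
    | succ K =>
      rw [show m + 1 + n = m + n + 1 by omega, gaussBinom_succ_succ, ih, ih,
        Finset.Nat.sum_antidiagonal_succ, Finset.Nat.sum_antidiagonal_succ, mul_add,
        Finset.mul_sum, add_left_comm, ← Finset.sum_add_distrib]
      congr 1
      · simp only [Nat.sub_zero, gaussBinom_zero_right]
        ring
      · refine Finset.sum_congr rfl fun p hp => ?_
        have hp' : p.1 + p.2 = K := by simpa using hp
        rw [gaussBinom_succ_succ, Nat.add_sub_add_right]
        -- When `m < p.1 + 1` the exponent `m - (p.1 + 1)` truncates, but it only accompanies a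
        -- vanishing binomial.
        rcases Nat.lt_or_ge m (p.1 + 1) with h | h
        · rw [gaussBinom_eq_zero_of_lt q h]
          simp
        · obtain ⟨d, rfl⟩ := Nat.exists_eq_add_of_le h
          have e1 : p.1 + 1 + d - p.1 = d + 1 := by omega
          have e2 : p.1 + 1 + d - (p.1 + 1) = d := by omega
          rw [e1, e2, ← hp']
          ring

lemma qPoch_succ {R : Type*} [CommRing R] (q : R) (n : ℕ) :
    qPoch q (n + 1) = qPoch q n * (1 - q ^ (n + 1)) := by
  rw [qPoch, qPoch, Finset.prod_Icc_succ_top (by omega)]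

@[simp] lemma qPoch_zero {R : Type*} [CommRing R] (q : R) : qPoch q 0 = 1 := by
  simp [qPoch]

/-- The two Pascal terms match the splitting `1 - q^(m+k+2) = (1 - q^(k+1)) + q^(k+1) (1 -
q^(m+1))`, whence the double induction. -/
lemma gaussBinom_mul_qPoch {R : Type*} [CommRing R] (q : R) (m k : ℕ) :
    gaussBinom q (m + k) k * (qPoch q k * qPoch q m) = qPoch q (m + k) := by
  induction k generalizing m with
  | zero => simp
  | succ k ihk =>
    induction m with
    | zero => simp
    | succ m ihm =>
      have h1 := ihk (m + 1)
      have e : m + (k + 1) = m + 1 + k := by omega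
      rw [e] at ihm
      rw [← Nat.add_assoc, gaussBinom_succ_succ, qPoch_succ q (m + 1 + k)]
      rw [qPoch_succ q k] at ihm ⊢
      rw [qPoch_succ q m] at h1 ⊢
      linear_combination (1 - q ^ (k + 1)) * h1 + q ^ (k + 1) * (1 - q ^ (m + 1)) * ihm

end GaussBinom

/-! ### Quotient formulas and the Saalschütz sum over a field. -/

section QField

variable {F : Type*} [Field F] {q : F}

lemma gaussBinom_eq_div (hq : ∀ n, qPoch q n ≠ 0) {n k : ℕ} (h : k ≤ n) :
    gaussBinom q n k = qPoch q n / (qPoch q k * qPoch q (n - k)) := by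
  obtain ⟨m, rfl⟩ := Nat.exists_eq_add_of_le' h
  rw [eq_div_iff (mul_ne_zero (hq _) (hq _)), Nat.add_sub_cancel, gaussBinom_mul_qPoch]

lemma gaussBinom_add_symm (hq : ∀ n, qPoch q n ≠ 0) {n i j : ℕ} (h : i + j = n) :
    gaussBinom q n i = gaussBinom q n j := by
  subst h
  rw [gaussBinom_eq_div hq (by omega), gaussBinom_eq_div hq (by omega), Nat.add_sub_cancel_left,
    Nat.add_sub_cancel, mul_comm]

lemma gaussBinom_mul_gaussBinom_sub (hq : ∀ n, qPoch q n ≠ 0) {b l j : ℕ} (hjl : j ≤ l) :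
    gaussBinom q b j * gaussBinom q (b - j) (l - j) = gaussBinom q b l * gaussBinom q l j := by
  rcases Nat.lt_or_ge b l with h | h
  · rcases Nat.lt_or_ge b j with h' | h'
    · rw [gaussBinom_eq_zero_of_lt q h, gaussBinom_eq_zero_of_lt q h']
      simp
    · rw [gaussBinom_eq_zero_of_lt q h, gaussBinom_eq_zero_of_lt q (show b - j < l - j by omega)]
      simp
  · rw [gaussBinom_eq_div hq h, gaussBinom_eq_div hq hjl, gaussBinom_eq_div hq (hjl.trans h),
      gaussBinom_eq_div hq (show l - j ≤ b - j by omega),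
      show b - j - (l - j) = b - l by omega]
    have := hq b
    have := hq j
    have := hq l
    have := hq (b - j)
    have := hq (l - j)
    have := hq (b - l)
    field_simp

lemma gaussBinom_mul_gaussBinom_add (hq : ∀ n, qPoch q n ≠ 0) (a : ℕ) {n l : ℕ} (h : l ≤ n) :
    gaussBinom q n l * gaussBinom q (a + n) n =
      gaussBinom q (a + l) l * gaussBinom q (a + n) (n - l) := by
  rw [gaussBinom_eq_div hq h, gaussBinom_eq_div hq (show n ≤ a + n by omega),
    gaussBinom_eq_div hq (show l ≤ a + l by omega),
    gaussBinom_eq_div hq (show n - l ≤ a + n by omega),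
    show a + n - (n - l) = a + l by omega, Nat.add_sub_cancel, Nat.add_sub_cancel]
  have := hq n
  have := hq l
  have := hq a
  have := hq (a + l)
  have := hq (n - l)
  have := hq (a + n)
  field_simp

lemma gaussBinom_succ_mul (hq : ∀ n, qPoch q n ≠ 0) (a n : ℕ) :
    gaussBinom q (a + n + 1) n * (1 - q ^ (a + 1)) =
      gaussBinom q (a + n) n * (1 - q ^ (a + n + 1)) := by
  have h1 := gaussBinom_mul_qPoch q (a + 1) n
  have h2 := gaussBinom_mul_qPoch q a n
  rw [show a + 1 + n = a + n + 1 by omega, qPoch_succ, qPoch_succ] at h1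
  refine mul_right_cancel₀ (mul_ne_zero (hq n) (hq a)) ?_
  linear_combination h1 - (1 - q ^ (a + n + 1)) * h2

/-- A terminating balanced `₃φ₂` sum (`q`-Pfaff–Saalschütz) in terms of Gaussian binomials. -/
theorem sum_gaussBinom_saalschutz (hq : ∀ n, qPoch q n ≠ 0) (a b N : ℕ) :
    ∑ j ∈ Finset.range (N + 1), q ^ ((j + 1) * j) * gaussBinom q (a + b + N + 1 - j) (N - j) *
        gaussBinom q (a + 1) (j + 1) * gaussBinom q b j =
      gaussBinom q (a + N + 1) (N + 1) * gaussBinom q (b + N + 1) N := by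
  -- Vandermonde with upper index split as `(a + N + 1) + (b - j)`. Trinomial revision then moves
  -- the `j`-dependence from `[b, j]` to `[l, j]`, so that `j` can be summed first.
  have hL : ∀ j ∈ Finset.range (N + 1),
      q ^ ((j + 1) * j) * gaussBinom q (a + b + N + 1 - j) (N - j) *
          gaussBinom q (a + 1) (j + 1) * gaussBinom q b j =
        ∑ l ∈ Finset.Ico j (N + 1), q ^ ((j + 1) * j + (a + l + 1) * (l - j)) *
          gaussBinom q (a + N + 1) (N - l) * gaussBinom q (a + 1) (j + 1) *
          (gaussBinom q b l * gaussBinom q l j) := by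
    intro j hj
    rw [Finset.mem_range] at hj
    rcases Nat.lt_or_ge b j with hb | hb
    · rw [gaussBinom_eq_zero_of_lt q hb, mul_zero, Finset.sum_eq_zero]
      intro l hl
      rw [gaussBinom_eq_zero_of_lt q (hb.trans_le (Finset.mem_Ico.mp hl).1)]
      simp
    · rw [show a + b + N + 1 - j = a + N + 1 + (b - j) by omega, gaussBinom_add_left,
        Finset.Nat.sum_antidiagonal_eq_sum_range_succ_mk, ← Finset.sum_flip,
        Finset.sum_Ico_eq_sum_range, show N - j + 1 = N + 1 - j by omega,
        Finset.mul_sum, Finset.sum_mul, Finset.sum_mul]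
      refine Finset.sum_congr rfl fun t ht => ?_
      rw [Finset.mem_range] at ht
      rw [← gaussBinom_mul_gaussBinom_sub hq (show j ≤ j + t by omega), pow_add]
      dsimp only
      rw [show N - j - (N - j - t) = t by omega, show N - j - t = N - (j + t) by omega,
        show a + N + 1 - (N - (j + t)) = a + (j + t) + 1 by omega, Nat.add_sub_cancel_left]
      ring
  have hR : gaussBinom q (b + N + 1) N = ∑ l ∈ Finset.range (N + 1),
      q ^ ((l + 1) * l) * gaussBinom q b l * gaussBinom q (N + 1) (l + 1) := by
    rw [show b + N + 1 = N + 1 + b by omega, gaussBinom_add_left,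
      Finset.Nat.sum_antidiagonal_eq_sum_range_succ_mk, ← Finset.sum_flip]
    refine Finset.sum_congr rfl fun l hl => ?_
    rw [Finset.mem_range] at hl
    dsimp only
    rw [show N - (N - l) = l by omega, show N + 1 - (N - l) = l + 1 by omega,
      gaussBinom_add_symm hq (show N - l + (l + 1) = N + 1 by omega)]
    ring
  have hM : ∀ l, gaussBinom q (a + (l + 1)) (l + 1) = ∑ j ∈ Finset.range (l + 1),
      q ^ ((a - j) * (l - j)) * gaussBinom q (a + 1) (j + 1) * gaussBinom q l j := by
    intro l
    rw [show a + (l + 1) = a + 1 + l by omega, gaussBinom_add_left,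
      Finset.Nat.sum_antidiagonal_succ, gaussBinom_eq_zero_of_lt q (Nat.lt_succ_self l), mul_zero,
      zero_add, Finset.Nat.sum_antidiagonal_eq_sum_range_succ_mk]
    refine Finset.sum_congr rfl fun j hj => ?_
    rw [Finset.mem_range] at hj
    dsimp only
    rw [gaussBinom_add_symm hq (show l - j + j = l by omega), Nat.add_sub_add_right]
  -- After the interchange, the inner sum over `j` is the Vandermonde expansion `hM` and the outer
  -- sum over `l` is `hR`.
  rw [Finset.sum_congr rfl hL, hR, Finset.mul_sum,
    Finset.sum_comm' (t' := Finset.range (N + 1)) (s' := fun l => Finset.range (l + 1))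
      (by intro x y; simp only [Finset.mem_range, Finset.mem_Ico]; omega)]
  refine Finset.sum_congr rfl fun l hl => ?_
  rw [Finset.mem_range] at hl
  have h := gaussBinom_mul_gaussBinom_add hq a (show l + 1 ≤ N + 1 by omega)
  rw [← Nat.add_assoc a N, hM l, Nat.add_sub_add_right] at h
  rw [mul_left_comm, mul_comm (gaussBinom q (a + N + 1) (N + 1)), h, Finset.sum_mul,
    Finset.mul_sum]
  refine Finset.sum_congr rfl fun j hj => ?_
  rw [Finset.mem_range] at hj
  rcases Nat.lt_or_ge a j with ha | ha
  · rw [gaussBinom_eq_zero_of_lt q (show a + 1 < j + 1 by omega)]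
    simp
  · obtain ⟨t, rfl⟩ := Nat.exists_eq_add_of_le (show j ≤ l by omega)
    obtain ⟨e, rfl⟩ := Nat.exists_eq_add_of_le ha
    rw [Nat.add_sub_cancel_left, Nat.add_sub_cancel_left]
    ring

end QField

/-! ### Transfer to `qBinom` with integer arguments. -/

section QBinom

lemma one_sub_ratFuncX_pow_ne_zero (n : ℕ) : (1 : RatFunc ℚ) - RatFunc.X ^ (n + 1) ≠ 0 := by
  intro h
  have h1 : (RatFunc.X : RatFunc ℚ) ^ (n + 1) = 1 := (sub_eq_zero.mp h).symm
  rw [← RatFunc.algebraMap_X, ← map_pow, ← map_one (algebraMap (Polynomial ℚ) (RatFunc ℚ))] at h1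
  have h2 := congrArg Polynomial.natDegree (RatFunc.algebraMap_injective ℚ h1)
  simp at h2

lemma qPoch_ratFuncX_ne_zero (n : ℕ) : qPoch (RatFunc.X : RatFunc ℚ) n ≠ 0 := by
  refine Finset.prod_ne_zero_iff.mpr fun k hk => ?_
  obtain ⟨j, rfl⟩ : ∃ j, k = j + 1 := ⟨k - 1, by have := Finset.mem_Icc.mp hk; omega⟩
  exact one_sub_ratFuncX_pow_ne_zero j

lemma qBinom_of_lt {n m : ℤ} (h : n < m) : qBinom n m = 0 := by
  rw [qBinom, if_neg (by omega)]

lemma qBinom_of_neg {n m : ℤ} (h : m < 0) : qBinom n m = 0 := by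
  rw [qBinom, if_neg (by omega)]

lemma qBinom_natCast (n k : ℕ) : qBinom n k = gaussBinom (RatFunc.X : RatFunc ℚ) n k := by
  rcases Nat.lt_or_ge n k with h | h
  · rw [gaussBinom_eq_zero_of_lt _ h, qBinom_of_lt (by omega)]
  · rw [gaussBinom_eq_div qPoch_ratFuncX_ne_zero h, qBinom, if_pos (by omega), Int.toNat_natCast,
      Int.toNat_natCast, ← Nat.cast_sub h, Int.toNat_natCast]
    rfl

lemma qBinom_eq_gaussBinom {n m : ℤ} {a k : ℕ} (hn : n = a) (hm : m = k) :
    qBinom n m = gaussBinom (RatFunc.X : RatFunc ℚ) a k := by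
  rw [hn, hm, qBinom_natCast]

lemma qBinom_zero_right {n : ℤ} (h : 0 ≤ n) : qBinom n 0 = 1 := by
  lift n to ℕ using h
  rw [qBinom_eq_gaussBinom rfl Nat.cast_zero.symm, gaussBinom_zero_right]

/-- For `x ≤ N` both sides vanish, so no lower bound on `x` is needed; the column recursion can make
`L` negative. The lower index `k - 1` is an integer, which kills the term `k = 0`. -/
theorem sum_qBinom_saalschutz (x : ℤ) (b N : ℕ) :
    ∑ k ∈ Finset.range (N + 2), (RatFunc.X : RatFunc ℚ) ^ (k * (k - 1)) *
        qBinom (x + b + 1 - k) (N + 1 - k) * qBinom (x - N) k * qBinom b (k - 1) =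
      qBinom x (N + 1) * qBinom (b + N + 1) N := by
  rw [Finset.sum_range_succ', qBinom_of_neg (n := b) (m := ((0 : ℕ) : ℤ) - 1) (by simp), mul_zero,
    add_zero]
  rcases lt_or_ge x (N + 1) with hx | hx
  · rw [qBinom_of_lt hx, zero_mul, Finset.sum_eq_zero]
    intro k _
    rw [qBinom_of_lt (n := x - N) (by push_cast; omega)]
    simp
  · obtain ⟨a, rfl⟩ : ∃ a : ℕ, x = ((a + N + 1 : ℕ) : ℤ) := ⟨(x - (N + 1)).toNat, by omega⟩
    rw [qBinom_eq_gaussBinom rfl (show (N : ℤ) + 1 = ((N + 1 : ℕ) : ℤ) by push_cast; rfl),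
      qBinom_eq_gaussBinom (show (b : ℤ) + N + 1 = ((b + N + 1 : ℕ) : ℤ) by push_cast; rfl) rfl,
      ← sum_gaussBinom_saalschutz qPoch_ratFuncX_ne_zero]
    refine Finset.sum_congr rfl fun k hk => ?_
    rw [Finset.mem_range] at hk
    rw [qBinom_eq_gaussBinom (a := a + b + N + 1 - k) (k := N - k) (by omega) (by omega),
      qBinom_eq_gaussBinom (a := a + 1) (k := k + 1) (by omega) rfl,
      qBinom_eq_gaussBinom (a := b) (k := k) rfl (by omega), Nat.add_sub_cancel]

theorem sum_qBinom_vandermonde (m b : ℕ) :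
    ∑ n ∈ Finset.range (b + 2), (RatFunc.X : RatFunc ℚ) ^ (n * (n - 1)) *
        qBinom m n * qBinom b (n - 1) = qBinom (m + b) (b + 1) := by
  rw [qBinom_eq_gaussBinom (a := b + m) (k := b + 1) (by push_cast; ring) (by push_cast; ring),
    gaussBinom_add_left, Finset.Nat.sum_antidiagonal_eq_sum_range_succ_mk]
  conv_rhs => rw [← Finset.sum_flip]
  refine Finset.sum_congr rfl fun n hn => ?_
  rw [Finset.mem_range] at hn
  dsimp only
  rcases n with _ | n
  · rw [qBinom_of_neg (n := b) (by simp), Nat.sub_zero, gaussBinom_eq_zero_of_lt _ (by omega)]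
    simp
  · rw [qBinom_natCast, qBinom_eq_gaussBinom (a := b) (k := n) rfl (by omega),
      show b + 1 - (n + 1) = b - n by omega, show b - (b - n) = n by omega,
      show b + 1 - (b - n) = n + 1 by omega, Nat.add_sub_cancel,
      gaussBinom_add_symm qPoch_ratFuncX_ne_zero (show b - n + n = b by omega)]
    ring

end QBinom

/-! ### Adding and deleting the first column of a diagram. -/

section Configurations

/-- `∑_{x ∈ M} min(i, x)`: the number of boxes in the first `i` columns of the diagram of `M`. -/
def columnSum (M : Multiset ℕ) (i : ℕ) : ℕ :=
  (M.map (min i)).sum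

/-- The multiset obtained from `M` by adding a column of length `card M + r` to its diagram. -/
def addColumn (M : Multiset ℕ) (r : ℕ) : Multiset ℕ :=
  M.map (· + 1) + Multiset.replicate r 1

lemma card_addColumn (M : Multiset ℕ) (r : ℕ) : (addColumn M r).card = M.card + r := by
  simp [addColumn]

lemma sum_addColumn (M : Multiset ℕ) (r : ℕ) : (addColumn M r).sum = M.sum + (M.card + r) := by
  simp [addColumn, Multiset.sum_map_add, add_assoc]

lemma pos_of_mem_addColumn {M : Multiset ℕ} {r i : ℕ} (h : i ∈ addColumn M r) : 0 < i := by
  simp only [addColumn, Multiset.mem_add, Multiset.mem_map, Multiset.mem_replicate] at h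
  rcases h with ⟨a, _, rfl⟩ | h <;> omega

lemma count_succ_addColumn (M : Multiset ℕ) (r : ℕ) {i : ℕ} (hi : i ≠ 0) :
    (addColumn M r).count (i + 1) = M.count i := by
  rw [addColumn, Multiset.count_add, Multiset.count_map_eq_count' _ _ (add_left_injective 1),
    Multiset.count_replicate, if_neg (by omega), add_zero]

lemma count_one_addColumn {M : Multiset ℕ} (r : ℕ) (h0 : 0 ∉ M) :
    (addColumn M r).count 1 = r := by
  have h := Multiset.count_map_eq_count' (· + 1) M (add_left_injective 1) 0
  rw [Multiset.count_eq_zero_of_notMem h0, zero_add] at h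
  rw [addColumn, Multiset.count_add, h, Multiset.count_replicate, if_pos rfl, zero_add]

lemma addColumn_left_inj {M M' : Multiset ℕ} {r r' : ℕ} (h0 : 0 ∉ M) (h0' : 0 ∉ M')
    (h : addColumn M r = addColumn M' r') : M = M' := by
  ext i
  rcases eq_or_ne i 0 with rfl | hi
  · rw [Multiset.count_eq_zero_of_notMem h0, Multiset.count_eq_zero_of_notMem h0']
  · rw [← count_succ_addColumn M r hi, h, count_succ_addColumn M' r' hi]

lemma exists_eq_addColumn {M : Multiset ℕ} (h0 : 0 ∉ M) :
    ∃ (M' : Multiset ℕ) (r : ℕ), 0 ∉ M' ∧ M = addColumn M' r := by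
  induction M using Multiset.induction_on with
  | empty => exact ⟨0, 0, by simp, by simp [addColumn]⟩
  | cons a M ih =>
    rw [Multiset.mem_cons, not_or] at h0
    obtain ⟨M', r, h', rfl⟩ := ih h0.2
    rcases a with _ | _ | a
    · exact absurd rfl h0.1
    · exact ⟨M', r + 1, h', by simp [addColumn, Multiset.replicate_succ]⟩
    · exact ⟨(a + 1) ::ₘ M', r, by simp [h'], by simp [addColumn]⟩

lemma columnSum_succ_addColumn (M : Multiset ℕ) (r i : ℕ) :
    columnSum (addColumn M r) (i + 1) = M.card + r + columnSum M i := by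
  have h : ∀ x : ℕ, min (i + 1) (x + 1) = min i x + 1 := fun x => by omega
  simp only [columnSum, addColumn, Multiset.map_add, Multiset.map_map, Function.comp_def, h,
    Multiset.sum_add, Multiset.sum_map_add, Multiset.map_replicate, Multiset.sum_replicate]
  simp
  ring

lemma columnSum_zero (M : Multiset ℕ) : columnSum M 0 = 0 := by
  simp [columnSum]

/-- The energy `∑_{x, y ∈ M} min(x, y)`. -/
def configEnergy (M : Multiset ℕ) : ℕ :=
  (M.map (columnSum M)).sum

/-- The energy is the sum of the squares of the column lengths. -/
lemma configEnergy_addColumn (M : Multiset ℕ) (r : ℕ) :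
    configEnergy (addColumn M r) = (M.card + r) ^ 2 + configEnergy M := by
  have h1 : columnSum (addColumn M r) 1 = M.card + r := by
    rw [← zero_add 1, columnSum_succ_addColumn, columnSum_zero, add_zero]
  rw [configEnergy]
  -- Only the multiset summed over is unfolded; the one inside `columnSum` stays folded for
  -- `columnSum_succ_addColumn`.
  nth_rewrite 2 [addColumn]
  simp only [Multiset.map_add, Multiset.map_map, Function.comp_def, columnSum_succ_addColumn,
    Multiset.sum_add, Multiset.sum_map_add, Multiset.map_replicate, Multiset.sum_replicate, h1,
    configEnergy]
  simp
  ring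

/-- The summand attached to `M` in the fermionic sums, with `K` factors and slope `c`. -/
noncomputable def configWeight (c : ℕ) (L : ℤ) (K : ℕ) (M : Multiset ℕ) : RatFunc ℚ :=
  RatFunc.X ^ configEnergy M * ∏ i ∈ Finset.range K,
    qBinom (L - 2 * columnSum M (i + 1) + M.count (i + 1) + c * (i + 1 : ℕ)) (M.count (i + 1))

/-- The new column adds its length to every later `columnSum`, and reindexing `i + 1` to `i`
releases one extra `c`; both are absorbed into `L`. Without `0 ∉ M`, zeros of `M` would be counted
among the new ones. -/
lemma configWeight_addColumn (c : ℕ) (L : ℤ) (K : ℕ) {M : Multiset ℕ} (r : ℕ) (h0 : 0 ∉ M) :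
    configWeight c L (K + 1) (addColumn M r) =
      RatFunc.X ^ (M.card + r) ^ 2 * qBinom (L + c - 2 * M.card - r) r *
        configWeight c (L - 2 * (M.card + r) + c) K M := by
  rw [configWeight, configWeight, configEnergy_addColumn, Finset.prod_range_succ', zero_add,
    count_one_addColumn r h0, pow_add]
  have h1 : columnSum (addColumn M r) 1 = M.card + r := by
    rw [← zero_add 1, columnSum_succ_addColumn, columnSum_zero, add_zero]
  have h2 : L - 2 * (columnSum (addColumn M r) 1 : ℕ) + r + c * (1 : ℕ) =
      L + c - 2 * M.card - r := by
    rw [h1]; push_cast; ring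
  have h3 : ∀ i ∈ Finset.range K,
      qBinom (L - 2 * columnSum (addColumn M r) (i + 1 + 1) + (addColumn M r).count (i + 1 + 1) +
        c * (i + 1 + 1 : ℕ)) ((addColumn M r).count (i + 1 + 1)) =
      qBinom (L - 2 * (M.card + r) + c - 2 * columnSum M (i + 1) + M.count (i + 1) +
        c * (i + 1 : ℕ)) (M.count (i + 1)) := by
    intro i _
    rw [count_succ_addColumn M r (Nat.succ_ne_zero i), columnSum_succ_addColumn]
    congr 1
    push_cast
    ring
  rw [h2, Finset.prod_congr rfl h3]
  ring

/-- The sum of `configWeight` over the partitions of `s` into `n` parts. -/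
noncomputable def configSum (c : ℕ) (L : ℤ) (K s n : ℕ) : RatFunc ℚ :=
  ∑ lam : s.Partition with lam.parts.card = n, configWeight c L K lam.parts

/-- Column deletion is a bijection onto partitions of `s` with at most `n` parts, and `n - k` is the
number of parts equal to `1` that disappear. -/
theorem configSum_succ (c : ℕ) (L : ℤ) (K s n : ℕ) :
    configSum c L (K + 1) (s + n) n = RatFunc.X ^ n ^ 2 *
      ∑ k ∈ Finset.range (n + 1),
        qBinom (L + c - n - k) (n - k) * configSum c (L - 2 * n + c) K s k := by
  have hfib : ∑ k ∈ Finset.range (n + 1),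
        qBinom (L + c - n - k) (n - k) * configSum c (L - 2 * n + c) K s k =
      ∑ mu : s.Partition with mu.parts.card ≤ n,
        qBinom (L + c - n - mu.parts.card) (n - mu.parts.card) *
          configWeight c (L - 2 * n + c) K mu.parts := by
    rw [← Finset.sum_fiberwise_of_maps_to (t := Finset.range (n + 1))
      (g := fun mu : s.Partition => mu.parts.card)
      (fun mu hmu => by simpa [Nat.lt_succ_iff] using hmu)]
    refine Finset.sum_congr rfl fun k hk => ?_
    rw [Finset.mem_range] at hk
    rw [configSum, Finset.mul_sum, Finset.filter_filter]
    refine Finset.sum_congr ?_ ?_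
    · ext mu
      simp only [Finset.mem_filter, Finset.mem_univ, true_and]
      omega
    · intro mu hmu
      rw [(Finset.mem_filter.mp hmu).2.2]
  have hpos : ∀ {t : ℕ} (mu : t.Partition), 0 ∉ mu.parts := fun mu h =>
    absurd (mu.parts_pos h) (lt_irrefl 0)
  rw [hfib, Finset.mul_sum, configSum]
  symm
  refine Finset.sum_bij
    (fun mu hmu => ⟨addColumn mu.parts (n - mu.parts.card), pos_of_mem_addColumn, by
      have : mu.parts.card ≤ n := (Finset.mem_filter.mp hmu).2
      rw [sum_addColumn, mu.parts_sum]
      omega⟩) ?_ ?_ ?_ ?_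
  · intro mu hmu
    have : mu.parts.card ≤ n := (Finset.mem_filter.mp hmu).2
    simp only [Finset.mem_filter, Finset.mem_univ, true_and, card_addColumn]
    omega
  · intro mu _ mu' _ h
    exact Nat.Partition.ext (addColumn_left_inj (hpos mu) (hpos mu')
      (congrArg Nat.Partition.parts h))
  · intro lam hlam
    have hc : lam.parts.card = n := (Finset.mem_filter.mp hlam).2
    obtain ⟨M, r, h0, hM⟩ := exists_eq_addColumn (hpos lam)
    have hs := lam.parts_sum
    rw [hM, card_addColumn] at hc
    rw [hM, sum_addColumn] at hs
    refine ⟨⟨M, fun {i} hi => Nat.pos_of_ne_zero fun h => h0 (h ▸ hi), by omega⟩, ?_, ?_⟩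
    · simp only [Finset.mem_filter, Finset.mem_univ, true_and]
      omega
    · refine Nat.Partition.ext ?_
      change addColumn M (n - M.card) = lam.parts
      rw [hM, show n - M.card = r by omega]
  · intro mu hmu
    have h : mu.parts.card ≤ n := (Finset.mem_filter.mp hmu).2
    dsimp only
    rw [configWeight_addColumn c L K _ (hpos mu), Nat.add_sub_cancel' h, Nat.cast_sub h,
      mul_assoc]
    congr 3
    · ring
    · ring

lemma configSum_eq_zero_of_lt (c : ℕ) (L : ℤ) (K : ℕ) {s n : ℕ} (h : s < n) :
    configSum c L K s n = 0 := by
  rw [configSum, Finset.sum_eq_zero]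
  intro lam hlam
  have hc : lam.parts.card = n := (Finset.mem_filter.mp hlam).2
  have h1 : lam.parts.card • 1 ≤ lam.parts.sum :=
    Multiset.card_nsmul_le_sum fun x hx => lam.parts_pos hx
  rw [lam.parts_sum, smul_eq_mul, mul_one] at h1
  omega

lemma configSum_succ_zero (c : ℕ) (L : ℤ) (K s : ℕ) : configSum c L K (s + 1) 0 = 0 := by
  rw [configSum, Finset.sum_eq_zero]
  intro lam hlam
  have hc : lam.parts = 0 := Multiset.card_eq_zero.mp (Finset.mem_filter.mp hlam).2
  have := lam.parts_sum
  rw [hc, Multiset.sum_zero] at this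
  omega

lemma configSum_zero_zero (c : ℕ) {L : ℤ} (hL : 0 ≤ L) (K : ℕ) : configSum c L K 0 0 = 1 := by
  have hw : configWeight c L K 0 = 1 := by
    rw [configWeight, Finset.prod_eq_one]
    · simp [configEnergy]
    · intro i _
      rw [Multiset.count_zero, columnSum, Multiset.map_zero, Multiset.sum_zero, Nat.cast_zero]
      exact qBinom_zero_right (by positivity)
  have hp : ∀ lam : Nat.Partition 0, lam.parts = 0 := fun lam =>
    Multiset.eq_zero_of_forall_notMem fun x hx => by
      have h1 := lam.parts_pos hx
      have h2 := Nat.Partition.le_of_mem_parts hx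
      omega
  rw [configSum, Finset.filter_true_of_mem fun lam _ => by rw [hp lam, Multiset.card_zero]]
  simp [hw]

end Configurations

/-! ### Product formulas for a fixed number of parts. -/

section ClosedForms

/-- Recursion for `configSum` when all parts are equal to `1`. -/
lemma configSum_self (c : ℕ) (L : ℤ) (K n : ℕ) :
    configSum c L (K + 1) (n + 1) (n + 1) =
      RatFunc.X ^ (n + 1) ^ 2 * qBinom (L + c - (n + 1)) (n + 1) := by
  have h := configSum_succ c L K 0 (n + 1)
  rw [zero_add] at h
  rw [h, Finset.sum_range_succ', Finset.sum_eq_zero, zero_add]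
  · push_cast
    rw [sub_zero, sub_zero]
    -- For a negative residual `L` the prefactor is zero, so the value of the empty configuration is
    -- irrelevant.
    rcases lt_or_ge (L - 2 * (n + 1) + c) 0 with hL | hL
    · rw [qBinom_of_lt (by omega), zero_mul]
    · rw [configSum_zero_zero c hL, mul_one]
  · intro k _
    rw [configSum_eq_zero_of_lt _ _ _ (Nat.succ_pos k), mul_zero]

/-- The bound `b + 1 ≤ K` survives the recursion: deleting a column lowers `K` by one and the size
by `n ≥ 1`. -/
theorem configSum_one_eq (L : ℤ) {K b : ℕ} (hK : b + 1 ≤ K) (n : ℕ) :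
    configSum 1 L K (b + 1) n =
      RatFunc.X ^ (b + 1 + n * (n - 1)) * qBinom (L - b) n * qBinom b (n - 1) := by
  induction K generalizing L b n with
  | zero => omega
  | succ K ih =>
    rcases n with _ | N
    · rw [configSum_succ_zero, qBinom_of_neg (n := b) (by simp), mul_zero]
    rcases lt_trichotomy b N with h | h | h
    · rw [configSum_eq_zero_of_lt _ _ _ (by omega), qBinom_of_lt (n := b) (by push_cast; omega),
        mul_zero]
    · subst h
      rw [configSum_self, qBinom_eq_gaussBinom (n := b) (a := b) (k := b) rfl (by push_cast; ring),
        gaussBinom_self, mul_one, Nat.add_sub_cancel]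
      congr 1
      · ring
      · congr 1
        push_cast
        ring
    · obtain ⟨d, rfl⟩ := Nat.exists_eq_add_of_lt h
      rw [show N + d + 1 + 1 = d + 1 + (N + 1) by omega, configSum_succ]
      have hs := sum_qBinom_saalschutz (L - (N + d + 1 : ℕ)) d N
      have hterm : ∀ k ∈ Finset.range (N + 1 + 1),
          qBinom (L + (1 : ℕ) - (N + 1 : ℕ) - k) ((N + 1 : ℕ) - k) *
            configSum 1 (L - 2 * (N + 1 : ℕ) + (1 : ℕ)) K (d + 1) k =
          RatFunc.X ^ (d + 1) * ((RatFunc.X : RatFunc ℚ) ^ (k * (k - 1)) *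
            qBinom (L - (N + d + 1 : ℕ) + d + 1 - k) (N + 1 - k) *
            qBinom (L - (N + d + 1 : ℕ) - N) k * qBinom d (k - 1)) := by
        intro k _
        rw [ih _ (by omega)]
        rw [show L - (N + d + 1 : ℕ) + d + 1 - k = L + (1 : ℕ) - (N + 1 : ℕ) - k by
            push_cast; ring,
          show L - 2 * (N + 1 : ℕ) + (1 : ℕ) - d = L - (N + d + 1 : ℕ) - N by push_cast; ring,
          pow_add, Nat.cast_add_one N]
        ring
      rw [Finset.sum_congr rfl hterm, ← Finset.mul_sum, hs, Nat.add_sub_cancel,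
        Nat.cast_add_one N, show ((N + d + 1 : ℕ) : ℤ) = d + N + 1 by push_cast; ring,
        add_sub_cancel_right]
      ring

/-- For `c = 0` column deletion preserves `d = L - 2s`, so `d` is a fixed parameter of the
induction. The denominator of the product formula is cleared. -/
theorem configSum_zero_mul_eq (d : ℕ) {K b : ℕ} (hK : b + 1 ≤ K) (n : ℕ) :
    configSum 0 (2 * b + 2 + d : ℕ) K (b + 1) n * (1 - RatFunc.X ^ (b + d + 2)) =
      RatFunc.X ^ (b + 1 + n * (n - 1)) * (1 - RatFunc.X ^ (d + 1)) *
        qBinom (b + d + 2 : ℕ) n * qBinom b (n - 1) := by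
  induction K generalizing b n with
  | zero => omega
  | succ K ih =>
    rcases n with _ | N
    · rw [configSum_succ_zero, qBinom_of_neg (n := b) (by simp), mul_zero, zero_mul]
    rcases lt_trichotomy b N with h | h | h
    · rw [configSum_eq_zero_of_lt _ _ _ (by omega), qBinom_of_lt (n := b) (by push_cast; omega),
        mul_zero, zero_mul]
    · subst h
      have hg := gaussBinom_succ_mul qPoch_ratFuncX_ne_zero d (b + 1)
      rw [configSum_self, qBinom_eq_gaussBinom (n := b) (a := b) (k := b) rfl (by push_cast; ring),
        gaussBinom_self, mul_one, Nat.add_sub_cancel,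
        qBinom_eq_gaussBinom (a := d + (b + 1)) (k := b + 1) (by push_cast; ring)
          (by push_cast; ring), qBinom_natCast,
        show b + d + 2 = d + (b + 1) + 1 by omega]
      linear_combination (-RatFunc.X ^ (b + 1) ^ 2) * hg
    · obtain ⟨e, rfl⟩ := Nat.exists_eq_add_of_lt h
      -- This is the denominator of the induction hypothesis for the smaller size `e + 1`.
      refine mul_right_cancel₀ (one_sub_ratFuncX_pow_ne_zero (e + d + 1)) ?_
      rw [show N + e + 1 + 1 = e + 1 + (N + 1) by omega, configSum_succ]
      have hs := sum_qBinom_saalschutz (e + d + N + 2 : ℕ) e N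
      have hterm : ∀ k ∈ Finset.range (N + 1 + 1),
          qBinom ((2 * (N + e + 1) + 2 + d : ℕ) + (0 : ℕ) - (N + 1 : ℕ) - k) ((N + 1 : ℕ) - k) *
            configSum 0 ((2 * (N + e + 1) + 2 + d : ℕ) - 2 * (N + 1 : ℕ) + (0 : ℕ)) K (e + 1) k *
              (1 - RatFunc.X ^ (e + d + 1 + 1)) =
          RatFunc.X ^ (e + 1) * (1 - RatFunc.X ^ (d + 1)) *
            ((RatFunc.X : RatFunc ℚ) ^ (k * (k - 1)) *
              qBinom ((e + d + N + 2 : ℕ) + e + 1 - k) (N + 1 - k) *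
              qBinom ((e + d + N + 2 : ℕ) - N) k * qBinom e (k - 1)) := by
        intro k _
        have hk := ih (b := e) (by omega) k
        rw [show ((2 * (N + e + 1) + 2 + d : ℕ) : ℤ) - 2 * (N + 1 : ℕ) + (0 : ℕ) =
            (2 * e + 2 + d : ℕ) by push_cast; ring, mul_assoc, hk,
          show ((2 * (N + e + 1) + 2 + d : ℕ) : ℤ) + (0 : ℕ) - (N + 1 : ℕ) - k =
            (e + d + N + 2 : ℕ) + e + 1 - k by push_cast; ring,
          show ((e + d + 2 : ℕ) : ℤ) = (e + d + N + 2 : ℕ) - N by push_cast; ring,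
          Nat.cast_add_one N, pow_add]
        ring
      -- Exchanges the denominator for size `e + 1` with the one for size `N + e + 2`.
      have hg := gaussBinom_succ_mul qPoch_ratFuncX_ne_zero (e + d + 1) (N + 1)
      have hsum := Finset.sum_congr rfl hterm
      rw [← Finset.sum_mul, ← Finset.mul_sum, hs,
        qBinom_eq_gaussBinom (a := e + d + 1 + (N + 1)) (k := N + 1) (by push_cast; ring)
          (by push_cast; ring)] at hsum
      rw [qBinom_eq_gaussBinom (n := ((N + e + 1 + d + 2 : ℕ) : ℤ))
          (a := e + d + 1 + (N + 1) + 1) (k := N + 1) (by push_cast; ring) rfl,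
        Nat.add_sub_cancel, Nat.cast_add_one N, add_sub_cancel_right,
        show ((N + e + 1 : ℕ) : ℤ) = e + N + 1 by push_cast; ring,
        show N + e + 1 + d + 2 = e + d + 1 + (N + 1) + 1 by omega]
      rw [Nat.cast_add_one N] at hsum
      linear_combination (RatFunc.X ^ (N + 1) ^ 2 *
          (1 - RatFunc.X ^ (e + d + 1 + (N + 1) + 1))) * hsum -
        (RatFunc.X ^ (e + 1 + (N + 1) ^ 2) * (1 - RatFunc.X ^ (d + 1)) *
          qBinom (e + N + 1) N) * hg

end ClosedForms

/-! ### Summation over the number of parts. -/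

section Main

lemma sum_partition_eq_sum_configSum (c : ℕ) (L : ℤ) (K s : ℕ) :
    ∑ lam : s.Partition, configWeight c L K lam.parts =
      ∑ n ∈ Finset.range (s + 1), configSum c L K s n := by
  refine (Finset.sum_fiberwise_of_maps_to (g := fun lam : s.Partition => lam.parts.card)
    (fun lam _ => ?_) _).symm
  have h1 : lam.parts.card • 1 ≤ lam.parts.sum :=
    Multiset.card_nsmul_le_sum fun x hx => lam.parts_pos hx
  rw [lam.parts_sum, smul_eq_mul, mul_one] at h1
  exact Finset.mem_range.mpr (Nat.lt_succ_of_le h1)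

lemma sum_partMult_mul {s : ℕ} (lam : s.Partition) (f : ℕ → ℕ) :
    ∑ j ∈ Finset.Icc 1 s, f j * partMult lam j = (lam.parts.map f).sum := by
  rw [Finset.sum_multiset_map_count]
  symm
  refine Finset.sum_subset_zero_on_sdiff ?_ ?_ ?_
  · intro j hj
    rw [Multiset.mem_toFinset] at hj
    exact Finset.mem_Icc.mpr ⟨lam.parts_pos hj, Nat.Partition.le_of_mem_parts hj⟩
  · intro j hj
    rw [Finset.mem_sdiff, Multiset.mem_toFinset] at hj
    rw [partMult, Multiset.count_eq_zero_of_notMem hj.2, mul_zero]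
  · intro j _
    rw [partMult, smul_eq_mul, mul_comm]

lemma vacancy_eq (L : ℕ) {s : ℕ} (lam : s.Partition) (i : ℕ) :
    vacancy L lam i = L - 2 * columnSum lam.parts i := by
  rw [vacancy, columnSum, ← sum_partMult_mul, Nat.cast_sum]

lemma phiEnergy_eq {s : ℕ} (lam : s.Partition) : phiEnergy lam = configEnergy lam.parts := by
  rw [configEnergy, ← sum_partMult_mul, phiEnergy]
  refine Finset.sum_congr rfl fun i _ => ?_
  rw [columnSum, ← sum_partMult_mul, Finset.sum_mul]
  exact Finset.sum_congr rfl fun j _ => by ring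

lemma summand_eq_configWeight (c L : ℕ) {s : ℕ} (lam : s.Partition) :
    (RatFunc.X : RatFunc ℚ) ^ phiEnergy lam * ∏ i ∈ Finset.Icc 1 s,
        qBinom (vacancy L lam i + (partMult lam i : ℤ) + c * (i : ℤ)) (partMult lam i : ℤ) =
      configWeight c L s lam.parts := by
  rw [phiEnergy_eq, configWeight, Finset.range_eq_Ico,
    Finset.prod_Ico_add' (fun i => qBinom ((L : ℤ) - 2 * columnSum lam.parts i +
      lam.parts.count i + c * (i : ℕ)) (lam.parts.count i)) 0 s 1]
  congr 1
  refine Finset.prod_congr (by ext i; simp [Nat.succ_le_iff]) fun i _ => ?_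
  rw [vacancy_eq, partMult]

theorem sum_configWeight_one {L s : ℕ} (h : s ≤ L) :
    ∑ lam : s.Partition, configWeight 1 L s lam.parts = RatFunc.X ^ s * qBinom L s := by
  rw [sum_partition_eq_sum_configSum]
  rcases s with _ | b
  · rw [zero_add, Finset.sum_range_one, configSum_zero_zero 1 (by omega), pow_zero, Nat.cast_zero,
      qBinom_zero_right (by omega), mul_one]
  · obtain ⟨m, rfl⟩ := Nat.exists_eq_add_of_le' ((Nat.le_succ b).trans h)
    rw [Nat.cast_add m b, Nat.cast_add_one b, ← sum_qBinom_vandermonde, Finset.mul_sum]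
    refine Finset.sum_congr rfl fun n _ => ?_
    rw [configSum_one_eq _ le_rfl, add_sub_cancel_right, pow_add]
    ring

theorem sum_configWeight_zero {L s : ℕ} (h : 2 * s ≤ L) :
    ∑ lam : s.Partition, configWeight 0 L s lam.parts = qBinom L s - qBinom L (s - 1) := by
  rw [sum_partition_eq_sum_configSum]
  rcases s with _ | b
  · rw [zero_add, Finset.sum_range_one, configSum_zero_zero 0 (by omega), Nat.cast_zero,
      qBinom_zero_right (by omega), qBinom_of_neg (by omega), sub_zero]
  · obtain ⟨d, hd⟩ := Nat.exists_eq_add_of_le h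
    obtain rfl : L = 2 * b + 2 + d := by omega
    refine mul_right_cancel₀ (one_sub_ratFuncX_pow_ne_zero (b + d + 1)) ?_
    have hv := sum_qBinom_vandermonde (b + d + 2) b
    have hsum : (∑ n ∈ Finset.range (b + 1 + 1),
          configSum 0 (2 * b + 2 + d : ℕ) (b + 1) (b + 1) n) *
          (1 - RatFunc.X ^ (b + d + 1 + 1)) =
        RatFunc.X ^ (b + 1) * (1 - RatFunc.X ^ (d + 1)) *
          qBinom ((b + d + 2 : ℕ) + b) (b + 1) := by
      rw [← hv, Finset.sum_mul, Finset.mul_sum]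
      refine Finset.sum_congr rfl fun n _ => ?_
      rw [configSum_zero_mul_eq d le_rfl, pow_add]
      ring
    have hg1 := gaussBinom_mul_qPoch (RatFunc.X : RatFunc ℚ) (b + d + 1) (b + 1)
    have hg2 := gaussBinom_mul_qPoch (RatFunc.X : RatFunc ℚ) (b + d + 2) b
    rw [show b + d + 2 + b = b + d + 1 + (b + 1) by omega, ← hg1, qPoch_succ _ b,
      qPoch_succ _ (b + d + 1)] at hg2
    -- The ratio of `[L, s-1]` to `[L, s]`. It turns their difference into `[L, s] (q^s - q^(L-s+1))
    -- / (1 - q^(L-s+1))`, the value found in `hsum`.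
    have hg : gaussBinom RatFunc.X (b + d + 1 + (b + 1)) b * (1 - RatFunc.X ^ (b + d + 2)) =
        gaussBinom (RatFunc.X : RatFunc ℚ) (b + d + 1 + (b + 1)) (b + 1) *
          (1 - RatFunc.X ^ (b + 1)) := by
      refine mul_right_cancel₀ (mul_ne_zero (qPoch_ratFuncX_ne_zero b)
        (qPoch_ratFuncX_ne_zero (b + d + 1))) ?_
      linear_combination hg2
    rw [hsum, qBinom_eq_gaussBinom (a := b + d + 1 + (b + 1)) (k := b + 1) (by push_cast; ring)
        (by push_cast; ring),
      qBinom_eq_gaussBinom (a := b + d + 1 + (b + 1)) (k := b + 1) (by push_cast; ring) rfl,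
      qBinom_eq_gaussBinom (a := b + d + 1 + (b + 1)) (k := b) (by push_cast; ring)
        (by push_cast; ring)]
    linear_combination hg

/-- In both parts the factors with `i > s` of the product over all `i ≥ 1` are equal to `1`: there
`m_i(λ) = 0`, and `p_i(λ) + i = L - 2 s + i > 0` if `s ≤ L`, while `p_i(λ) = L - 2 s ≥ 0` if
`2 s ≤ L`. So the product is written over `1 ≤ i ≤ s`. -/
theorem mainTheorem4 (L s : ℕ) :
    (s ≤ L →
      qBinom (L : ℤ) (s : ℤ) =
        (RatFunc.X : RatFunc ℚ) ^ (-(s : ℤ)) *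
          ∑ lam : s.Partition, (RatFunc.X : RatFunc ℚ) ^ phiEnergy lam *
            ∏ i ∈ Finset.Icc 1 s,
              qBinom (vacancy L lam i + (partMult lam i : ℤ) + (i : ℤ)) (partMult lam i : ℤ)) ∧
    (2 * s ≤ L →
      qBinom (L : ℤ) (s : ℤ) - qBinom (L : ℤ) ((s : ℤ) - 1) =
        ∑ lam : s.Partition, (RatFunc.X : RatFunc ℚ) ^ phiEnergy lam *
          ∏ i ∈ Finset.Icc 1 s,
            qBinom (vacancy L lam i + (partMult lam i : ℤ)) (partMult lam i : ℤ)) := by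
  constructor
  · intro h
    have hw : ∀ lam : s.Partition, (RatFunc.X : RatFunc ℚ) ^ phiEnergy lam *
        ∏ i ∈ Finset.Icc 1 s, qBinom (vacancy L lam i + (partMult lam i : ℤ) + (i : ℤ))
          (partMult lam i : ℤ) = configWeight 1 L s lam.parts := fun lam => by
      simpa only [Nat.cast_one, one_mul] using summand_eq_configWeight 1 L lam
    rw [Finset.sum_congr rfl fun lam _ => hw lam, sum_configWeight_one h, zpow_neg, zpow_natCast,
      inv_mul_cancel_left₀ (pow_ne_zero _ RatFunc.X_ne_zero)]
  · intro h
    have hw : ∀ lam : s.Partition, (RatFunc.X : RatFunc ℚ) ^ phiEnergy lam *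
        ∏ i ∈ Finset.Icc 1 s, qBinom (vacancy L lam i + (partMult lam i : ℤ))
          (partMult lam i : ℤ) = configWeight 0 L s lam.parts := fun lam => by
      simpa only [Nat.cast_zero, zero_mul, add_zero] using summand_eq_configWeight 0 L lam
    rw [Finset.sum_congr rfl fun lam _ => hw lam, sum_configWeight_zero h]

end Main
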